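/- **Model.** A radio network is a finite undirected graph whose vertices are processors acting in synchronous rounds. In every round each processor either transmits or keeps silent; a processor receives something in a round if and only if it keeps silent and precisely one of its neighbours transmits (a collision is not distinguishable from silence). A broadcast starts at a source. Only processors that already hold the message (the source, and those that have received a transmission before) may transmit; there are no spontaneous transmissions. A transmission carries the message and may carry arbitrary further content from a countable alphabet. A randomized protocol determines, from the random coins, the name of a vertex and the list of what that vertex has received in the past rounds, whether and what the vertex transmits. The protocol is fixed, and the coins are drawn, independently of the random choices made in constructing the network below; so it may depend on everything else, including the number of vertices and the diameter. **Core graph.** Let $s=2^m$, $m\ge 0$, and let $\log$ denote the logarithm to base 2. Take a perfect binary tree with $s$ leaves; let $S$ be its set of leaves, and let $N$ be the disjoint union of sets $N_w$ over all tree nodes $w$, where $|N_w|=2^j$ if $w$ has height $j$ above the leaves. A leaf $z\in S$ is adjacent to $v\in N_w$ if and only if $w$ is an ancestor of $z$ (or $z$ itself). Thus $|S|=s$ and $|N|=s\log 2s$. **Chain.** For $k\ge1$, take $k$ copies of the core graph with sides $S^i,N^i$, $1\le i\le k$, and a root $rt=rt^0$; choose $rt^i\in N^i$ uniformly at random, independently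 for $1\le i\le k$, and join $rt^{i-1}$ to all vertices of $S^i$ for $1\le i\le k$. The chain has $1+k\,s\log 4s$ vertices. **Theorem.** (1) Let a broadcast start at the root $rt$ joined to all vertices of $S$ in a single core graph, let $0\le i\le(\log 2s)/2$ be a real number, and consider any protocol and any outcome of its coins. If after $t$ rounds the message has reached at least one vertex, and at least a $\bigl(2i/\log 2s\bigr)$-fraction, of $N$, then $t\ge 1+i$. (2) There are a constant $c>0$ and, for every real $C$, a constant $A_C$ such that the following holds for all integers $D\ge 2$ and $n\ge 2\lfloor D/2\rfloor+1$. Let $s$ be the largest power of two for which the chain of $k=\lfloor D/2\rfloor$ core graphs has at most $n$ vertices; it then has at least $n/3$ vertices. For every choice of the vertices $rt^i$, the chain is connected and its diameter lies between $2k$ and $2k+2$. Let $R$ be the number of rounds until the message, broadcast from $rt$, reaches $rt^{k}$, and let $T\ge R$ be the number of rounds until it has reached all vertices ($\infty$ if this never happens). For every randomized protocol, with probability taken over the choice of the $rt^i$ and the coins of the protocol, * $\mathbb E(R)\ge c\,D\log(n/D)$ and $\mathbb E(T)\ge c\,D\log(n/D)$; * for every real $C$ with $D\ge A_C\log n$: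 $\ \mathbb P\bigl(R\ge c\,D\log(n/D)\bigr)\ge 1-n^{-C}$ and $\mathbb P\bigl(T\ge c\,D\log(n/D)\bigr)\ge 1-n^{-C}$. -/

import Mathlib

namespace RadioBroadcast

/-! ### Radio networks

Processors sit at the vertices of a graph and act in synchronous rounds. -/

section Radio

variable {V M : Type*}

/-- A (deterministic) strategy: what a processor sitting at a given vertex does in the coming round,
as a function of the list of everything it received in the past rounds (most recent round first;
the entry is `none` if nothing was received in that round). The value `some a` means that it
transmits the content `a`, the value `none` that it keeps silent. The strategy is not told the
graph; the list has one entry per past round, so the processors share a clock. -/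
abbrev Strategy (V M : Type*) : Type _ := V → List (Option M) → Option M

open Classical in
/-- What `v` receives if every vertex `u` performs `a u`: the content sent by a neighbour of `v`, if
`v` keeps silent and precisely one neighbour transmits; otherwise nothing (a collision cannot be
distinguished from silence). -/
noncomputable def received (G : SimpleGraph V) (a : V → Option M) (v : V) : Option M :=
  if h : a v = none ∧ ∃! u, G.Adj v u ∧ a u ≠ none then a h.2.choose else none

/-- A vertex is active if it is the source or has received a transmission before. Every
transmission carries the broadcast message (plus arbitrary additional content). -/
def Active (src v : V) (h : List (Option M)) : Prop :=
  v = src ∨ ∃ a : M, some a ∈ h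

open Classical in
/-- The action of `v`: it follows the strategy once it holds the message, and keeps silent before
(there are no spontaneous transmissions). -/
noncomputable def action (src : V) (σ : Strategy V M) (v : V) (h : List (Option M)) : Option M :=
  if Active src v h then σ v h else none

/-- The list of what `v` received in the first `t` rounds of a broadcast started at `src`. -/
noncomputable def history (G : SimpleGraph V) (src : V) (σ : Strategy V M) :
    ℕ → V → List (Option M)
  | 0, _ => []
  | t + 1, v =>
      received G (fun u => action src σ u (history G src σ t u)) v :: history G src σ t v

/-- The broadcast message has reached `v` within `t` rounds. -/
def Informed (G : SimpleGraph V) (src : V) (σ : Strategy V M) (t : ℕ) (v : V) : Prop :=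
  Active src v (history G src σ t v)

/-- The number of rounds until the message reaches `v` (`⊤` if it never does). -/
noncomputable def reachTime (G : SimpleGraph V) (src : V) (σ : Strategy V M) (v : V) : ℕ∞ :=
  ⨅ (t : ℕ) (_ : Informed G src σ t v), (t : ℕ∞)

/-- The number of rounds until the message has reached all vertices (`⊤` if this never happens). -/
noncomputable def broadcastTime (G : SimpleGraph V) (src : V) (σ : Strategy V M) : ℕ∞ :=
  ⨅ (t : ℕ) (_ : ∀ v, Informed G src σ t v), (t : ℕ∞)

end Radio

/-! ### The core graph, for `s = 2 ^ m`

The perfect binary tree with `s` leaves `0, …, s - 1`: the ancestor of the leaf `z` at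
inverse-level `j` (height `j` above the leaves) is the node number `z / 2 ^ j` of that
inverse-level. -/

/-- The side `S` of the core graph: the leaves of the tree. -/
abbrev CoreS (m : ℕ) : Type := Fin (2 ^ m)

/-- The side `N` of the core graph: `s` vertices for each inverse-level `j = 0, …, m`. The vertex
`(j, y)` belongs to the set `N_w` of the node `w` number `y / 2 ^ j` at inverse-level `j`, so that
`N_w` has `2 ^ j` elements. -/
abbrev CoreN (m : ℕ) : Type := Fin (m + 1) × Fin (2 ^ m)

/-- A leaf `z` is adjacent to all elements of `N_w` for all its ancestors `w` (including itself). -/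
def CoreAdj {m : ℕ} (z : CoreS m) (v : CoreN m) : Prop :=
  z.val / 2 ^ v.1.val = v.2.val / 2 ^ v.1.val

/-! ### The chain of `k` core graphs -/

/-- The vertices of the chain: the root (`none`) and `k` copies of the core graph. -/
abbrev ChainVertex (k m : ℕ) : Type := Option (Fin k × (CoreS m ⊕ CoreN m))

/-- The root `rt = rt⁰`. -/
def root {k m : ℕ} : ChainVertex k m := none

/-- The vertex `z` of the side `S` of copy `i`. -/
def inS {k m : ℕ} (i : Fin k) (z : CoreS m) : ChainVertex k m := some (i, Sum.inl z)

/-- The vertex `v` of the side `N` of copy `i`. -/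
def inN {k m : ℕ} (i : Fin k) (v : CoreN m) : ChainVertex k m := some (i, Sum.inr v)

/-- The vertices `rt⁰, rt¹, …, rtᵏ`: the root, followed by the vertex `g i` that was selected in the
side `N` of each copy. -/
def relay {k m : ℕ} (g : Fin k → CoreN m) : Fin (k + 1) → ChainVertex k m :=
  Fin.cases root (fun i => inN i (g i))

/-- The chain: in each copy the edges of the core graph, and all edges between the side `S` of a
copy and the relay vertex that precedes the copy. -/
def chain {k m : ℕ} (g : Fin k → CoreN m) : SimpleGraph (ChainVertex k m) :=
  SimpleGraph.fromRel fun x y =>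
    ∃ (i : Fin k) (z : CoreS m), y = inS i z ∧
      (x = relay g i.castSucc ∨ ∃ v : CoreN m, x = inN i v ∧ CoreAdj z v)

/-- The law of the selected vertices: independent and uniform in the sides `N` of the copies. -/
noncomputable def selection (k m : ℕ) : MeasureTheory.Measure (Fin k → CoreN m) :=
  MeasureTheory.Measure.pi fun _ => ProbabilityTheory.uniformOn Set.univ

end RadioBroadcast

open RadioBroadcast MeasureTheory

open RadioBroadcast MeasureTheory

namespace RadioBroadcast

/-! ### Unique coverage in the core graph -/

section Coverage

/-! The whole bound rests on one property of the core graph: whatever subset `X` of the leaves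
transmits, at most `2s` of the `(m + 1) s` vertices of `N` hear exactly one of them
(`ncard_uniquely_covered_le`). If exactly one leaf of `X` lies below a tree node, one of the two
subtrees below it contains no leaf of `X` and contributes nothing, so the count at most doubles from
one height to the next. Hence `j` rounds of transmissions from `S` inform at most `2sj` vertices of
`N` (`ncard_informed_le`). With the one round needed to reach `S`, this is the first part.

In the chain, what happens in copy `i` until `rt^i` is informed is determined by the protocol and
the earlier choices alone: the later copies are silent, and no vertex can tell which element of
`N^i` was selected (`history_chain_eq_chainUpTo`, `chainUpTo_congr`). So for a fixed protocol `rt^i`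
is uniform given the past, and with `J = ⌊(m + 1) / 32⌋` it is among the first `2sJ` informed
vertices with conditional probability at most `1/16`. Call the copy fast in that case; any other
copy costs at least `J + 2` rounds (`not_informed_relay_succ_of_not_fastCopy`).

A union bound over the sets of fast copies shows that at least half of the copies are fast with
probability at most `2^k * 16^(-k/2) = 2^(-k)` (`card_half_adapted_le`). Otherwise `rt^k` takes at
least `(J + 2)(⌊k/2⌋ + 1)` rounds, which is of order `D log (n / D)` because `log (n / D) ≤ 2m + 3`.
Fubini over the coins extends this from deterministic to randomized protocols
(`measureReal_slowEvent_ge`). -/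

open Classical in
/-- Indicator of the node number `w` at height `j` having exactly one descendant leaf in `X`. -/
noncomputable def uniqueLeaf (X : Set ℕ) (j w : ℕ) : ℕ :=
  if ∃! x, x ∈ X ∧ x / 2 ^ j = w then 1 else 0

theorem uniqueLeaf_le_one (X : Set ℕ) (j w : ℕ) : uniqueLeaf X j w ≤ 1 := by
  unfold uniqueLeaf; split_ifs <;> omega

/-- The number of vertices of `N` attached to the subtree of the node number `w` at height `j`
that have exactly one neighbour in `X`. -/
noncomputable def subtreeCount (X : Set ℕ) (j w : ℕ) : ℕ :=
  ∑ y ∈ Finset.Ico (w * 2 ^ j) ((w + 1) * 2 ^ j),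
    ∑ l ∈ Finset.range (j + 1), uniqueLeaf X l (y / 2 ^ l)

theorem subtreeCount_succ (X : Set ℕ) (j w : ℕ) :
    subtreeCount X (j + 1) w =
      2 ^ (j + 1) * uniqueLeaf X (j + 1) w +
        (subtreeCount X j (2 * w) + subtreeCount X j (2 * w + 1)) := by
  have hlast : ∑ y ∈ Finset.Ico (w * 2 ^ (j + 1)) ((w + 1) * 2 ^ (j + 1)),
      uniqueLeaf X (j + 1) (y / 2 ^ (j + 1)) = 2 ^ (j + 1) * uniqueLeaf X (j + 1) w := by
    rw [Finset.sum_congr rfl (g := fun _ => uniqueLeaf X (j + 1) w)]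
    · rw [Finset.sum_const, Nat.card_Ico, ← Nat.sub_mul, smul_eq_mul]; simp
    · intro y hy
      rw [Finset.mem_Ico] at hy
      rw [Nat.div_eq_of_lt_le hy.1 hy.2]
  unfold subtreeCount
  simp_rw [Finset.sum_range_succ _ (j + 1)]
  rw [Finset.sum_add_distrib, hlast, add_comm]
  congr 1
  -- The interval of `w` splits into the intervals of its children `2 * w` and `2 * w + 1`.
  rw [← Finset.sum_Ico_consecutive _ (m := w * 2 ^ (j + 1)) (n := (2 * w + 1) * 2 ^ j)]
  · congr 3 <;> ring
  · rw [pow_succ]; nlinarith [Nat.zero_le (2 ^ j)]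
  · rw [pow_succ]; nlinarith [Nat.zero_le (2 ^ j)]

theorem div_two_pow_succ (x j : ℕ) : x / 2 ^ (j + 1) = x / 2 ^ j / 2 := by
  rw [pow_succ, Nat.div_div_eq_div_mul]

theorem subtreeCount_eq_zero (X : Set ℕ) (j w : ℕ) (h : ∀ x ∈ X, x / 2 ^ j ≠ w) :
    subtreeCount X j w = 0 := by
  induction j generalizing w with
  | zero =>
    simp only [subtreeCount, Finset.sum_eq_zero_iff, Finset.mem_Ico, Finset.mem_range]
    intro y hy l hl
    obtain rfl : l = 0 := by omega
    refine if_neg ?_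
    rintro ⟨x, ⟨hx, hxy⟩, -⟩
    refine h x hx ?_
    simp only [pow_zero, Nat.div_one, mul_one] at *
    omega
  | succ j ih =>
    have h' : ∀ x ∈ X, x / 2 ^ j / 2 ≠ w := fun x hx => by
      rw [← div_two_pow_succ]; exact h x hx
    rw [subtreeCount_succ, ih (2 * w), ih (2 * w + 1), uniqueLeaf, if_neg]
    · simp
    · rintro ⟨x, ⟨hx, hxy⟩, -⟩
      exact h x hx hxy
    · intro x hx hxw
      exact h' x hx (by omega)
    · intro x hx hxw
      exact h' x hx (by omega)

/-- Induction on the height. If the top node sees a unique leaf of `X`, its own `2 ^ (j + 1)`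
vertices count, but the child that is not above this leaf contributes zero. If not, only the two
children contribute. Both cases give at most `2 * 2 ^ (j + 1)`. -/
theorem subtreeCount_le (X : Set ℕ) (j w : ℕ) : subtreeCount X j w ≤ 2 ^ (j + 1) := by
  induction j generalizing w with
  | zero =>
    have : subtreeCount X 0 w = uniqueLeaf X 0 w := by
      simp [subtreeCount]
    have := uniqueLeaf_le_one X 0 w
    omega
  | succ j ih =>
    rw [subtreeCount_succ]
    have h1 := ih (2 * w)
    have h2 := ih (2 * w + 1)
    have hp : 2 ^ (j + 1 + 1) = 2 * 2 ^ (j + 1) := by ring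
    by_cases hu : ∃! x, x ∈ X ∧ x / 2 ^ (j + 1) = w
    · have hU : uniqueLeaf X (j + 1) w = 1 := if_pos hu
      obtain ⟨x, ⟨hx, hxw⟩, huniq⟩ := hu
      have hdiv := div_two_pow_succ
      rcases Nat.mod_two_eq_zero_or_one (x / 2 ^ j) with hm | hm
      · have : subtreeCount X j (2 * w + 1) = 0 := by
          refine subtreeCount_eq_zero _ _ _ fun y hy hyw => ?_
          have := huniq y ⟨hy, by rw [hdiv]; omega⟩
          subst this; omega
        rw [hU]; omega
      · have : subtreeCount X j (2 * w) = 0 := by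
          refine subtreeCount_eq_zero _ _ _ fun y hy hyw => ?_
          have := huniq y ⟨hy, by rw [hdiv]; omega⟩
          subst this; omega
        rw [hU]; omega
    · have hU : uniqueLeaf X (j + 1) w = 0 := if_neg hu
      rw [hU]; omega

/-- At most `2s` vertices of `N` have exactly one neighbour in a given subset of `S`. -/
theorem ncard_uniquely_covered_le {m : ℕ} (X : Set (CoreS m)) :
    {v : CoreN m | ∃! z, z ∈ X ∧ CoreAdj z v}.ncard ≤ 2 * 2 ^ m := by
  classical
  have hiff : ∀ v : CoreN m, (∃! z, z ∈ X ∧ CoreAdj z v) →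
      ∃! x, x ∈ Fin.val '' X ∧ x / 2 ^ v.1.val = v.2.val / 2 ^ v.1.val := by
    rintro v ⟨z, ⟨hz, hzv⟩, hu⟩
    refine ⟨z.val, ⟨⟨z, hz, rfl⟩, hzv⟩, ?_⟩
    rintro _ ⟨⟨y, hy, rfl⟩, hyv⟩
    rw [hu y ⟨hy, hyv⟩]
  rw [Set.ncard_eq_toFinset_card', Set.toFinset_ofFinset, Finset.card_filter]
  calc ∑ v : CoreN m, (if ∃! z, z ∈ X ∧ CoreAdj z v then 1 else 0)
      ≤ ∑ v : CoreN m, uniqueLeaf (Fin.val '' X) v.1.val (v.2.val / 2 ^ v.1.val) := by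
        refine Finset.sum_le_sum fun v _ => ?_
        unfold uniqueLeaf
        split_ifs with h h' <;> first | exact absurd (hiff v h) h' | omega
    _ = subtreeCount (Fin.val '' X) m 0 := by
        rw [Fintype.sum_prod_type, Finset.sum_comm]
        simp only [subtreeCount, zero_mul, zero_add, one_mul]
        rw [← Finset.range_eq_Ico, Finset.sum_range]
        refine Finset.sum_congr rfl fun y _ => ?_
        rw [Finset.sum_range]
    _ ≤ 2 ^ (m + 1) := subtreeCount_le _ _ _
    _ = 2 * 2 ^ m := by ring

end Coverage

/-! ### General facts on broadcasts -/

section Dynamics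

variable {V M : Type*} {G : SimpleGraph V} {src : V} {σ : Strategy V M}

theorem informed_of_action_ne_none {u : V} {t : ℕ}
    (h : action src σ u (history G src σ t u) ≠ none) : Informed G src σ t u := by
  unfold action at h
  by_contra hn
  exact h (if_neg hn)

theorem not_informed_zero {v : V} (hv : v ≠ src) : ¬ Informed G src σ 0 v := by
  rintro (h | ⟨a, ha⟩)
  · exact hv h
  · simp [history] at ha

theorem existsUnique_of_received_ne_none {a : V → Option M} {v : V}
    (h : received G a v ≠ none) : ∃! u, G.Adj v u ∧ a u ≠ none := by
  unfold received at h
  split_ifs at h with h'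
  · exact h'.2
  · exact absurd rfl h

theorem Informed.succ {t : ℕ} {v : V} (h : Informed G src σ t v) : Informed G src σ (t + 1) v := by
  rcases h with h | ⟨a, ha⟩
  · exact Or.inl h
  · exact Or.inr ⟨a, List.mem_cons_of_mem _ ha⟩

theorem Informed.mono {t t' : ℕ} (htt : t ≤ t') {v : V} (h : Informed G src σ t v) :
    Informed G src σ t' v := by
  induction htt with
  | refl => exact h
  | step _ ih => exact ih.succ

theorem informed_succ {t : ℕ} {v : V} (h : Informed G src σ (t + 1) v) :
    Informed G src σ t v ∨
      ∃! u, G.Adj v u ∧ action src σ u (history G src σ t u) ≠ none := by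
  rcases h with h | ⟨a, ha⟩
  · exact Or.inl (Or.inl h)
  · rw [history, List.mem_cons] at ha
    rcases ha with ha | ha
    · exact Or.inr (existsUnique_of_received_ne_none (ha ▸ Option.some_ne_none a))
    · exact Or.inl (Or.inr ⟨a, ha⟩)

/-- The message enters a set `U` of vertices only through its outer boundary `w`. -/
theorem not_informed_of_boundary {U : Set V} {w : V} (hsrc : src ∉ U)
    (hU : ∀ x ∈ U, ∀ y, G.Adj x y → y ∈ U ∨ y = w) {t : ℕ}
    (hw : ∀ t' < t, ¬ Informed G src σ t' w) : ∀ x ∈ U, ¬ Informed G src σ t x := by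
  induction t with
  | zero => exact fun x hx => not_informed_zero (fun h => hsrc (h ▸ hx))
  | succ t ih =>
    have ih := ih fun t' ht => hw t' (by omega)
    intro x hx h
    rcases informed_succ h with h | ⟨u, ⟨hadj, hu⟩, -⟩
    · exact ih x hx h
    · have hu := informed_of_action_ne_none hu
      rcases hU x hx u hadj with h | rfl
      · exact ih u h hu
      · exact hw t (by omega) hu

theorem received_congr {G' : SimpleGraph V} {a a' : V → Option M} {v : V} (hv : a v = a' v)
    (h : ∀ u, (G.Adj v u ∧ a u ≠ none) ↔ (G'.Adj v u ∧ a' u ≠ none))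
    (h' : ∀ u, G.Adj v u → a u ≠ none → a u = a' u) : received G a v = received G' a' v := by
  unfold received
  have hiff : (a v = none ∧ ∃! u, G.Adj v u ∧ a u ≠ none) ↔
      (a' v = none ∧ ∃! u, G'.Adj v u ∧ a' u ≠ none) := by
    rw [hv]
    simp only [h]
  split_ifs with h1 h2 h2
  · have e1 := h1.2.choose_spec.1
    have e2 : h1.2.choose = h2.2.choose :=
      h2.2.unique ((h _).1 e1) h2.2.choose_spec.1
    rw [h' _ e1.1 e1.2, e2]
  · exact absurd (hiff.1 h1) h2
  · exact absurd (hiff.2 h2) h1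
  · rfl

/-- If the histories of a set `U` agree in two broadcasts so far, the graphs agree on `U`, and all
neighbours outside of `U` are silent, then the next receptions agree as well. -/
theorem history_succ_congr {G' : SimpleGraph V} {U : Set V} {t : ℕ}
    (hist : ∀ x ∈ U, history G src σ t x = history G' src σ t x)
    (hadj : ∀ x ∈ U, ∀ y ∈ U, G.Adj x y ↔ G'.Adj x y)
    (hout : ∀ x ∈ U, ∀ y ∉ U, ¬ G'.Adj x y)
    (hsilent : ∀ y ∉ U, ¬ Informed G src σ t y) :
    ∀ x ∈ U, history G src σ (t + 1) x = history G' src σ (t + 1) x := by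
  intro x hx
  rw [history, history, hist x hx]
  congr 1
  refine received_congr (by rw [hist x hx]) (fun u => ?_) fun u hadj' hu => ?_
  · by_cases hu : u ∈ U
    · rw [hist u hu, hadj x hx u hu]
    · refine ⟨fun h => absurd (informed_of_action_ne_none h.2) (hsilent u hu), fun h => ?_⟩
      exact absurd h.1 (hout x hx u hu)
  · by_cases hu' : u ∈ U
    · rw [hist u hu']
    · exact absurd (informed_of_action_ne_none hu) (hsilent u hu')

theorem natCast_le_reachTime {v : V} {r : ℕ} (h : ∀ t < r, ¬ Informed G src σ t v) :
    (r : ℕ∞) ≤ reachTime G src σ v := by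
  refine le_iInf₂ fun t ht => ?_
  by_contra hlt
  exact h t (by exact_mod_cast not_le.1 hlt) ht

theorem reachTime_le_broadcastTime (v : V) :
    reachTime G src σ v ≤ broadcastTime G src σ :=
  le_iInf₂ fun t ht => iInf₂_le t (ht v)

end Dynamics

end RadioBroadcast

namespace RadioBroadcast

/-! ### Broadcasts on the chain -/

section Chain

variable {k m : ℕ} {M : Type*}

/-- The chain without the edges of the copies after the copy `i`. -/
def chainUpTo (g : Fin k → CoreN m) (i : Fin k) : SimpleGraph (ChainVertex k m) :=
  SimpleGraph.fromRel fun x y =>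
    ∃ (j : Fin k) (z : CoreS m), j ≤ i ∧ y = inS j z ∧
      (x = relay g j.castSucc ∨ ∃ v : CoreN m, x = inN j v ∧ CoreAdj z v)

theorem chainUpTo_eq_chain (g : Fin k → CoreN m) {i : Fin k} (hi : ∀ j, j ≤ i) :
    chainUpTo g i = chain g := by
  simp only [chainUpTo, chain, hi, true_and]

/-- The vertices of the copies from the copy `i` on. -/
def upper (k m : ℕ) (i : ℕ) : Set (ChainVertex k m) :=
  {x | ∃ (j : Fin k) (y : _), i ≤ j ∧ x = some (j, y)}

theorem inS_mem_upper {i : ℕ} {j : Fin k} {z : CoreS m} : inS j z ∈ upper k m i ↔ i ≤ j := by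
  simp [upper, inS]

theorem inN_mem_upper {i : ℕ} {j : Fin k} {v : CoreN m} : inN j v ∈ upper k m i ↔ i ≤ j := by
  simp only [upper, inN, Set.mem_ofPred_eq, Option.some.injEq, Prod.mk.injEq]
  exact ⟨fun ⟨_, _, h, hj, _⟩ => hj ▸ h, fun h => ⟨j, _, h, rfl, rfl⟩⟩

theorem root_notMem_upper {i : ℕ} : root ∉ upper k m i := by simp [upper, root]

theorem relay_succ (g : Fin k → CoreN m) (i : Fin k) : relay g i.succ = inN i (g i) := rfl

theorem relay_eq_root_or (g : Fin k → CoreN m) (i : Fin (k + 1)) :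
    (i = 0 ∧ relay g i = root) ∨ ∃ j : Fin k, i = j.succ ∧ relay g i = inN j (g j) := by
  cases i using Fin.cases with
  | zero => exact Or.inl ⟨rfl, rfl⟩
  | succ j => exact Or.inr ⟨j, rfl, rfl⟩

theorem relay_ne_inS (g : Fin k → CoreN m) (i : Fin (k + 1)) (j : Fin k) (z : CoreS m) :
    relay g i ≠ inS j z := by
  rcases relay_eq_root_or g i with ⟨-, h⟩ | ⟨l, -, h⟩ <;> rw [h] <;> simp [root, inN, inS]

theorem inS_injective {j j' : Fin k} {z z' : CoreS m} (h : inS j z = inS j' z') :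
    j = j' ∧ z = z' := by
  simpa [inS] using h

theorem inN_injective {j j' : Fin k} {v v' : CoreN m} (h : inN j v = inN j' v') :
    j = j' ∧ v = v' := by
  simpa [inN] using h

theorem inN_ne_inS {j j' : Fin k} {v : CoreN m} {z : CoreS m} : inN j v ≠ inS j' z := by
  simp [inN, inS]

theorem chain_adj_iff {g : Fin k → CoreN m} {x y : ChainVertex k m} : (chain g).Adj x y ↔
    (∃ (j : Fin k) (z : CoreS m), y = inS j z ∧
      (x = relay g j.castSucc ∨ ∃ v : CoreN m, x = inN j v ∧ CoreAdj z v)) ∨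
    (∃ (j : Fin k) (z : CoreS m), x = inS j z ∧
      (y = relay g j.castSucc ∨ ∃ v : CoreN m, y = inN j v ∧ CoreAdj z v)) := by
  rw [chain, SimpleGraph.fromRel_adj, and_iff_right_of_imp]
  rintro (⟨j, z, rfl, rfl | ⟨v, rfl, -⟩⟩ | ⟨j, z, rfl, rfl | ⟨v, rfl, -⟩⟩)
  · exact relay_ne_inS _ _ _ _
  · exact inN_ne_inS
  · exact (relay_ne_inS _ _ _ _).symm
  · exact inN_ne_inS.symm

theorem chainUpTo_adj_iff {g : Fin k → CoreN m} {i : Fin k} {x y : ChainVertex k m} :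
    (chainUpTo g i).Adj x y ↔
    (∃ (j : Fin k) (z : CoreS m), j ≤ i ∧ y = inS j z ∧
      (x = relay g j.castSucc ∨ ∃ v : CoreN m, x = inN j v ∧ CoreAdj z v)) ∨
    (∃ (j : Fin k) (z : CoreS m), j ≤ i ∧ x = inS j z ∧
      (y = relay g j.castSucc ∨ ∃ v : CoreN m, y = inN j v ∧ CoreAdj z v)) := by
  rw [chainUpTo, SimpleGraph.fromRel_adj, and_iff_right_of_imp]
  rintro (⟨j, z, -, rfl, rfl | ⟨v, rfl, -⟩⟩ | ⟨j, z, -, rfl, rfl | ⟨v, rfl, -⟩⟩)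
  · exact relay_ne_inS _ _ _ _
  · exact inN_ne_inS
  · exact (relay_ne_inS _ _ _ _).symm
  · exact inN_ne_inS.symm

/-- Copy `j` is attached to the vertex selected in the copy before it, so the choice in copy `i`
itself leaves no trace in the truncated chain. This is what makes `rt^i` independent of the
broadcast there. -/
theorem chainUpTo_congr {g g' : Fin k → CoreN m} {i : Fin k} (h : ∀ j < i, g j = g' j) :
    chainUpTo g i = chainUpTo g' i := by
  have hr : ∀ j ≤ i, relay g j.castSucc = relay g' j.castSucc := by
    intro j hj
    rcases relay_eq_root_or g j.castSucc with ⟨h0, -⟩ | ⟨l, hl, -⟩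
    · rw [h0]; rfl
    -- With copies numbered from 0, `relay g j.castSucc` lies in copy `j - 1`.
    · have : (l : ℕ) + 1 = j := by simpa using (congrArg Fin.val hl).symm
      rw [hl, relay_succ, relay_succ, h l (Fin.lt_def.2 (by have := Fin.le_def.1 hj; omega))]
  ext x y
  rw [chainUpTo_adj_iff, chainUpTo_adj_iff]
  constructor
  all_goals
    rintro (⟨j, z, hj, hy⟩ | ⟨j, z, hj, hy⟩)
    · exact Or.inl ⟨j, z, hj, by simpa only [hr j hj] using hy⟩
    · exact Or.inr ⟨j, z, hj, by simpa only [hr j hj] using hy⟩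

/-- After truncation even the selected vertex of copy `i` hears only `S^i`; in the whole chain it
would also hear the next copy. This supplies the hypothesis `hH` of `ncard_informed_le`. -/
theorem chainUpTo_adj_inN {g : Fin k → CoreN m} {i : Fin k} {v : CoreN m} {x : ChainVertex k m} :
    (chainUpTo g i).Adj (inN i v) x ↔ ∃ z, x = inS i z ∧ CoreAdj z v := by
  rw [chainUpTo_adj_iff]
  constructor
  · rintro (⟨j, z, hj, rfl, h | ⟨v', h, hz⟩⟩ | ⟨j, z, -, h, -⟩)
    · rcases relay_eq_root_or g j.castSucc with ⟨-, h0⟩ | ⟨l, hl, h0⟩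
      · rw [h0] at h; simp [inN, root] at h
      · rw [h0] at h
        obtain ⟨rfl, -⟩ := inN_injective h
        have : (i : ℕ) + 1 = j := by simpa using (congrArg Fin.val hl).symm
        have := Fin.le_def.1 hj
        omega
    · obtain ⟨rfl, rfl⟩ := inN_injective h
      exact ⟨z, rfl, hz⟩
    · exact absurd h inN_ne_inS
  · rintro ⟨z, rfl, hz⟩
    exact Or.inl ⟨i, z, le_rfl, rfl, Or.inr ⟨v, rfl, hz⟩⟩

/-- The only edges leaving the copies from `i` on join the side `S` of copy `i` to the preceding
relay vertex, which is therefore a bottleneck for the message. -/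
theorem chain_adj_upper {g : Fin k → CoreN m} {i : Fin k} {x y : ChainVertex k m}
    (hx : x ∈ upper k m i) (h : (chain g).Adj x y) :
    y ∈ upper k m i ∨ y = relay g i.castSucc := by
  rcases chain_adj_iff.1 h with ⟨j, z, rfl, h | ⟨v, rfl, -⟩⟩ | ⟨j, z, rfl, h | ⟨v, rfl, -⟩⟩
  · left
    rw [inS_mem_upper]
    rcases relay_eq_root_or g j.castSucc with ⟨-, h0⟩ | ⟨l, hl, h0⟩
    · rw [h, h0] at hx; exact absurd hx root_notMem_upper
    · rw [h, h0, inN_mem_upper] at hx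
      have : (l : ℕ) + 1 = j := by simpa using (congrArg Fin.val hl).symm
      omega
  · rw [inN_mem_upper] at hx; rw [inS_mem_upper]; exact Or.inl hx
  · rw [inS_mem_upper] at hx
    rcases relay_eq_root_or g j.castSucc with ⟨h1, h0⟩ | ⟨l, hl, h0⟩
    · right
      have : (j : ℕ) = 0 := by simpa using congrArg Fin.val h1
      have : i = j := Fin.ext (by omega)
      rw [h, this]
    · have : (l : ℕ) + 1 = j := by simpa using (congrArg Fin.val hl).symm
      by_cases hij : i = j
      · right; rw [h, hij]
      · left
        rw [h, h0, inN_mem_upper]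
        have : (i : ℕ) ≠ j := fun h => hij (Fin.ext h)
        omega
  · rw [inS_mem_upper] at hx; rw [inN_mem_upper]; exact Or.inl hx

/-! ### Progress of the broadcast inside one copy. -/

variable {σ : Strategy (ChainVertex k m) M} {g : Fin k → CoreN m} {i : Fin k}

/-- No copy from the copy `i` on is reached before the round after the relay vertex preceding the
copy `i` is reached. -/
theorem not_informed_upper {t : ℕ}
    (h : ∀ t' < t, ¬ Informed (chain g) root σ t' (relay g i.castSucc)) :
    ∀ x ∈ upper k m i, ¬ Informed (chain g) root σ t x :=
  not_informed_of_boundary root_notMem_upper (fun _ hx _ h => chain_adj_upper hx h) h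

/-- If the side `S` is not reached in `b` rounds, then `b + 1 + j` rounds reach at most `2 s j`
vertices of the side `N`. -/
theorem ncard_informed_le {H : SimpleGraph (ChainVertex k m)}
    (hH : ∀ v x, H.Adj (inN i v) x ↔ ∃ z, x = inS i z ∧ CoreAdj z v) {b : ℕ}
    (hb : ∀ z, ¬ Informed H root σ b (inS i z)) (j : ℕ) :
    {v : CoreN m | Informed H root σ (b + 1 + j) (inN i v)}.ncard ≤ j * (2 * 2 ^ m) := by
  induction j with
  | zero =>
    -- The side `N` is always informed at least one round after `S`, hence the offset `b + 1`.
    have hNb : ∀ b', (∀ b'' < b', ∀ z, ¬ Informed H root σ b'' (inS i z)) →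
        ∀ v, ¬ Informed H root σ b' (inN i v) := by
      intro b' hb'
      induction b' with
      | zero => exact fun v => not_informed_zero (by simp [inN, root])
      | succ b' ih =>
        intro v h
        rcases informed_succ h with h | ⟨u, ⟨hadj, hu⟩, -⟩
        · exact ih (fun b'' hb'' => hb' b'' (by omega)) v h
        · obtain ⟨z, rfl, -⟩ := (hH v u).1 hadj
          exact hb' b' (by omega) z (informed_of_action_ne_none hu)
    have : {v : CoreN m | Informed H root σ (b + 1 + 0) (inN i v)} = ∅ := by
      refine Set.eq_empty_iff_forall_notMem.2 (hNb _ fun b'' hb'' z h => hb z (h.mono (by omega)))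
    rw [this]; simp
  | succ j ih =>
    -- The leaves that transmit in the coming round; a newly informed vertex of `N` has exactly one
    -- neighbour among them.
    set X : Set (CoreS m) := {z | action root σ (inS i z) (history H root σ (b + 1 + j) (inS i z))
      ≠ none} with hX
    have hsub : {v : CoreN m | Informed H root σ (b + 1 + (j + 1)) (inN i v)} ⊆
        {v : CoreN m | Informed H root σ (b + 1 + j) (inN i v)} ∪
          {v : CoreN m | ∃! z, z ∈ X ∧ CoreAdj z v} := by
      intro v hv
      rcases informed_succ (t := b + 1 + j) hv with h | ⟨u, ⟨hadj, hu⟩, huniq⟩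
      · exact Or.inl h
      · obtain ⟨z, rfl, hz⟩ := (hH v u).1 hadj
        refine Or.inr ⟨z, ⟨hu, hz⟩, fun y hy => ?_⟩
        exact (inS_injective (huniq (inS i y) ⟨(hH v _).2 ⟨y, rfl, hy.2⟩, hy.1⟩)).2
    calc _ ≤ _ := Set.ncard_le_ncard hsub
      _ ≤ _ := Set.ncard_union_le _ _
      _ ≤ j * (2 * 2 ^ m) + 2 * 2 ^ m := add_le_add ih (ncard_uniquely_covered_le X)
      _ = (j + 1) * (2 * 2 ^ m) := by ring

/-- As long as the relay vertex of the copy `i` is not reached, the later copies are irrelevant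
to what happens in the copies up to `i`. -/
theorem history_chain_eq_chainUpTo {t : ℕ}
    (h : ∀ t' < t, ¬ Informed (chain g) root σ t' (inN i (g i))) :
    ∀ x ∈ (upper k m (i + 1))ᶜ,
      history (chain g) root σ t x = history (chainUpTo g i) root σ t x := by
  induction t with
  | zero => exact fun x _ => rfl
  | succ t ih =>
    have hlow : ∀ (j : Fin k) (z : CoreS m) x, j ≤ i →
        (x = relay g j.castSucc ∨ ∃ v : CoreN m, x = inN j v ∧ CoreAdj z v) →
        x ∉ upper k m (i + 1) := by
      rintro j z x hj (rfl | ⟨v, rfl, -⟩)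
      · rcases relay_eq_root_or g j.castSucc with ⟨-, h0⟩ | ⟨l, hl, h0⟩
        · rw [h0]; exact root_notMem_upper
        · have : (l : ℕ) + 1 = j := by simpa using (congrArg Fin.val hl).symm
          have := Fin.le_def.1 hj
          rw [h0, inN_mem_upper]; omega
      · have := Fin.le_def.1 hj
        rw [inN_mem_upper]; omega
    refine history_succ_congr (ih fun t' ht' => h t' (by omega)) ?_ ?_ ?_
    · intro x hx y hy
      rw [chain_adj_iff, chainUpTo_adj_iff]
      constructor
      · rintro (⟨j, z, rfl, hj⟩ | ⟨j, z, rfl, hj⟩)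
        · rw [Set.mem_compl_iff, inS_mem_upper] at hy
          exact Or.inl ⟨j, z, Fin.le_def.2 (by omega), rfl, hj⟩
        · rw [Set.mem_compl_iff, inS_mem_upper] at hx
          exact Or.inr ⟨j, z, Fin.le_def.2 (by omega), rfl, hj⟩
      · rintro (⟨j, z, -, h⟩ | ⟨j, z, -, h⟩)
        · exact Or.inl ⟨j, z, h⟩
        · exact Or.inr ⟨j, z, h⟩
    · intro x hx y hy hadj
      rw [Set.notMem_compl_iff] at hy
      rcases chainUpTo_adj_iff.1 hadj with ⟨j, z, hj, rfl, -⟩ | ⟨j, z, hj, rfl, h'⟩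
      · have := Fin.le_def.1 hj
        rw [inS_mem_upper] at hy; omega
      · exact hlow j z y hj h' hy
    · intro y hy
      rw [Set.notMem_compl_iff] at hy
      obtain ⟨j, y, hj, rfl⟩ := hy
      have hik : (i : ℕ) + 1 < k := by omega
      have hr : relay g (Fin.castSucc ⟨i + 1, hik⟩) = inN i (g i) := by
        rw [← relay_succ]; rfl
      exact not_informed_upper (i := ⟨i + 1, hik⟩)
        (fun t' ht' => by rw [hr]; exact h t' (by omega)) _ ⟨j, y, hj, rfl⟩

/-- The relay vertex of the copy `i` is among the vertices that are reached in the first `J` rounds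
in which the side `S` of the copy can be active. -/
def FastCopy (σ : Strategy (ChainVertex k m) M) (J : ℕ) (g : Fin k → CoreN m) (i : Fin k) : Prop :=
  ∃ b, (∀ z, ¬ Informed (chainUpTo g i) root σ b (inS i z)) ∧
    Informed (chainUpTo g i) root σ (b + 1 + J) (inN i (g i))

theorem fastCopy_congr {J : ℕ} {g' : Fin k → CoreN m} (h : ∀ j ≤ i, g j = g' j) :
    FastCopy σ J g i ↔ FastCopy σ J g' i := by
  unfold FastCopy
  rw [chainUpTo_congr fun j hj => h j hj.le, h i le_rfl]

/-- Resampling the choice in copy `i` leaves the truncated broadcast unchanged, so the choices that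
make the copy fast form a fixed set of reached vertices, to which `ncard_informed_le` applies. -/
theorem ncard_fastCopy_update_le (J : ℕ) :
    {v : CoreN m | FastCopy σ J (Function.update g i v) i}.ncard ≤ J * (2 * 2 ^ m) := by
  set F : ℕ → Set (CoreN m) := fun b =>
    {v | (∀ z, ¬ Informed (chainUpTo g i) root σ b (inS i z)) ∧
      Informed (chainUpTo g i) root σ (b + 1 + J) (inN i v)} with hF
  have hset : {v : CoreN m | FastCopy σ J (Function.update g i v) i} = ⋃ b, F b := by
    ext v
    have : chainUpTo (Function.update g i v) i = chainUpTo g i :=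
      chainUpTo_congr fun j hj => Function.update_of_ne hj.ne _ _
    simp [FastCopy, this, hF]
  have hbound : ∀ b, (∀ z, ¬ Informed (chainUpTo g i) root σ b (inS i z)) →
      (F b).ncard ≤ J * (2 * 2 ^ m) := fun b hb =>
    (Set.ncard_le_ncard fun v hv => hv.2).trans
      (ncard_informed_le (fun v x => chainUpTo_adj_inN) hb J)
  rw [hset]
  -- The sets `F b` increase as long as `S` is uninformed at time `b` and are empty afterwards, so
  -- the last such `b` gives the whole union. If `S` is never informed, neither is `N`, and the
  -- union is empty.
  by_cases hall : ∃ b, ∃ z, Informed (chainUpTo g i) root σ b (inS i z)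
  · classical
    obtain ⟨z, hz⟩ := Nat.find_spec hall
    have hmin := fun b hb => Nat.find_min (m := b) hall hb
    rcases hb : Nat.find hall with _ | b
    · rw [hb] at hz
      exact absurd hz (not_informed_zero (by simp [inS, root]))
    · rw [hb] at hz hmin
      have hb' : ∀ z, ¬ Informed (chainUpTo g i) root σ b (inS i z) := fun z hz =>
        hmin b (by omega) ⟨z, hz⟩
      refine (Set.ncard_le_ncard (Set.iUnion_subset fun b' v hv => ?_)).trans (hbound b hb')
      have : b' ≤ b := by
        by_contra hlt
        exact hv.1 z (hz.mono (by omega))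
      exact ⟨hb', hv.2.mono (by omega)⟩
  · push Not at hall
    have : ⋃ b, F b = ∅ := by
      refine Set.eq_empty_iff_forall_notMem.2 fun v hv => ?_
      obtain ⟨b, -, hv⟩ := Set.mem_iUnion.1 hv
      have := (Set.ncard_le_ncard (s := {v}) (Set.singleton_subset_iff.2
        (show v ∈ {v | Informed (chainUpTo g i) root σ (b + 1 + J + 1 + 0) (inN i v)} from
          hv.mono (by omega)))).trans
        (ncard_informed_le (fun v x => chainUpTo_adj_inN) (fun z => hall (b + 1 + J) z) 0)
      simp at this
    rw [this]; simp

/-! ### Adding up the delays of the copies. -/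

theorem not_informed_relay_succ {a : ℕ}
    (h : ∀ t < a, ¬ Informed (chain g) root σ t (relay g i.castSucc)) :
    ∀ t < a + 1, ¬ Informed (chain g) root σ t (relay g i.succ) := fun t ht hinf =>
  not_informed_upper h _ (inN_mem_upper.2 le_rfl) (hinf.mono (by omega : t ≤ a))

/-- If the preceding relay vertex is uninformed before time `a`, then `S` is uninformed at time `a`.
Slowness with `b = a` leaves `rt^i` uninformed at time `a + 1 + J`, the last time below `a + (J +
2)`. -/
theorem not_informed_relay_succ_of_not_fastCopy {J a : ℕ} (hslow : ¬ FastCopy σ J g i)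
    (h : ∀ t < a, ¬ Informed (chain g) root σ t (relay g i.castSucc)) :
    ∀ t < a + (J + 2), ¬ Informed (chain g) root σ t (relay g i.succ) := by
  have hloc : ∀ t, (∀ t' < t, ¬ Informed (chain g) root σ t' (inN i (g i))) →
      ∀ x ∉ upper k m (i + 1),
        (Informed (chain g) root σ t x ↔ Informed (chainUpTo g i) root σ t x) := by
    intro t ht x hx
    unfold Informed
    rw [history_chain_eq_chainUpTo ht x hx]
  have hup := not_informed_upper h
  have hS : ∀ z, ¬ Informed (chainUpTo g i) root σ a (inS i z) := by
    intro z
    rw [← hloc a (fun t ht hinf => hup _ (inN_mem_upper.2 le_rfl) (hinf.mono ht.le)) _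
      (by rw [inS_mem_upper]; omega)]
    exact hup _ (inS_mem_upper.2 le_rfl)
  have hN : ¬ Informed (chainUpTo g i) root σ (a + 1 + J) (inN i (g i)) := fun hinf =>
    hslow ⟨a, hS, hinf⟩
  rw [relay_succ]
  intro t
  -- The truncated and the full chain agree at time `t` only if `rt^i` was uninformed before in the
  -- full chain, which is the induction hypothesis.
  induction t using Nat.strong_induction_on with
  | _ t ih =>
    intro ht hinf
    rw [hloc t (fun t' ht' => ih t' ht' (by omega)) _ (by rw [inN_mem_upper]; omega)] at hinf
    exact hN (hinf.mono (by omega))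

-- Each slow copy before position `l` contributes `J + 2` rounds; the progress made in fast copies
-- is simply discarded.
open Classical in
theorem not_informed_relay (J : ℕ) (l : ℕ) (hl : l ≤ k) :
    ∀ t < (J + 2) * (Finset.univ.filter fun i : Fin k => (i : ℕ) < l ∧ ¬ FastCopy σ J g i).card,
      ¬ Informed (chain g) root σ t (relay g ⟨l, by omega⟩) := by
  induction l with
  | zero => simp
  | succ l ih =>
    have ih := ih (by omega)
    set i : Fin k := ⟨l, hl⟩
    by_cases hf : FastCopy σ J g i
    · have : (Finset.univ.filter fun i : Fin k => (i : ℕ) < l + 1 ∧ ¬ FastCopy σ J g i) =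
          Finset.univ.filter fun i : Fin k => (i : ℕ) < l ∧ ¬ FastCopy σ J g i := by
        ext j
        simp only [Finset.mem_filter, Finset.mem_univ, true_and]
        refine and_congr_left fun hj => ⟨fun hlt => ?_, fun hlt => by omega⟩
        have : (j : ℕ) ≠ l := fun he => hj (by rwa [show j = i from Fin.ext he])
        omega
      rw [this]
      exact fun t ht => not_informed_relay_succ (i := i) ih t (by omega)
    · have : (Finset.univ.filter fun i : Fin k => (i : ℕ) < l + 1 ∧ ¬ FastCopy σ J g i) ⊆
          insert i (Finset.univ.filter fun i : Fin k => (i : ℕ) < l ∧ ¬ FastCopy σ J g i) := by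
        intro j
        simp only [Finset.mem_filter, Finset.mem_univ, true_and, Finset.mem_insert]
        rintro ⟨hj, hj'⟩
        by_cases he : (j : ℕ) = l
        · exact Or.inl (Fin.ext he)
        · exact Or.inr ⟨by omega, hj'⟩
      have hc := (Finset.card_le_card this).trans (Finset.card_insert_le _ _)
      refine fun t ht => not_informed_relay_succ_of_not_fastCopy (i := i) hf ih t ?_
      exact ht.trans_le ((Nat.mul_le_mul_left _ hc).trans_eq (by ring))

end Chain

end RadioBroadcast

namespace RadioBroadcast

/-! ### Sequentially adapted rare events -/

section Counting

open Classical in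
/-- If `p g i` depends only on the first coordinates of `g` up to `i`, and for each `i` a fraction
of at most `1 / q` of the values of the coordinate `i` makes it true, then a fraction of at most
`1 / q ^ |F|` of all `g` satisfies `p g i` for all `i ∈ F`. -/
theorem card_adapted_le {k : ℕ} {α : Type*} [Fintype α] {p : (Fin k → α) → Fin k → Prop} {q : ℕ}
    (hloc : ∀ g g' i, (∀ j ≤ i, g j = g' j) → (p g i ↔ p g' i))
    (hfib : ∀ g i, q * (Finset.univ.filter fun v => p (Function.update g i v) i).card ≤
      Fintype.card α) (F : Finset (Fin k)) :
    q ^ F.card * (Finset.univ.filter fun g => ∀ i ∈ F, p g i).card ≤ Fintype.card α ^ k := by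
  rcases isEmpty_or_nonempty α with hα | hα
  · rcases Nat.eq_zero_or_pos k with rfl | hk
    · have : F = ∅ := Finset.eq_empty_of_isEmpty F
      subst this
      simp
    · have : IsEmpty (Fin k → α) := ⟨fun g => hα.elim (g ⟨0, hk⟩)⟩
      simp
  have hpos : 0 < Fintype.card α := Fintype.card_pos
  -- Adding the indices in increasing order ensures that the events already treated do not see the
  -- new coordinate `i`.
  induction F using Finset.induction_on_max with
  | empty => simp
  | insert i F hmax ih =>
    have hi : i ∉ F := fun h => lt_irrefl _ (hmax i h)
    set B := Finset.univ.filter fun g : Fin k → α => ∀ j ∈ F, p g j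
    set B' := Finset.univ.filter fun g : Fin k → α => ∀ j ∈ insert i F, p g j
    have hcard : B'.card * Fintype.card α ≤
        ∑ g ∈ B, (Finset.univ.filter fun v => p (Function.update g i v) i).card := by
      rw [← Finset.card_sigma, ← Finset.card_univ, ← Finset.card_product]
      -- Exchange the coordinate `g i` with the free value `v`. The new function still lies in `B`,
      -- as only coordinate `i` changed, and `g i` lies in its fibre because putting it back
      -- recovers `g`.
      refine Finset.card_le_card_of_injOn
        (fun x => ⟨Function.update x.1 i x.2, x.1 i⟩) ?_ ?_
      · rintro ⟨g, v⟩ hg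
        simp only [B', B, Finset.coe_product, Set.mem_prod, Finset.mem_coe, Finset.mem_filter,
          Finset.mem_univ, true_and, and_true, Finset.forall_mem_insert, Finset.mem_sigma,
          Function.update_idem, Function.update_eq_self] at hg ⊢
        refine ⟨fun j hj => ?_, hg.1⟩
        rw [hloc _ g j fun l hl => Function.update_of_ne (hl.trans_lt (hmax j hj)).ne _ _]
        exact hg.2 j hj
      · rintro ⟨g, v⟩ - ⟨g', v'⟩ - h
        simp only [Sigma.mk.injEq, heq_eq_eq] at h
        have h1 : v = v' := by simpa using congrFun h.1 i
        have h2 : g = g' := by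
          have := congrArg (fun f => Function.update f i (g i)) h.1
          simp only [Function.update_idem, Function.update_eq_self] at this
          rw [this, h.2, Function.update_eq_self]
        rw [h1, h2]
    have h2 : q * (B'.card * Fintype.card α) ≤ B.card * Fintype.card α := by
      refine (Nat.mul_le_mul_left q hcard).trans ?_
      rw [Finset.mul_sum]
      exact (Finset.sum_le_sum fun g _ => hfib g i).trans_eq (by simp)
    have h3 : q * B'.card ≤ B.card := by
      rw [← mul_assoc] at h2
      exact Nat.le_of_mul_le_mul_right h2 hpos
    rw [Finset.card_insert_of_notMem hi, pow_succ, mul_assoc]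
    exact (Nat.mul_le_mul_left _ h3).trans ih

open Classical in
/-- The number of `g` for which at least half of the adapted events occur, if each has
conditional probability at most `1 / 16`. -/
theorem card_half_adapted_le {k : ℕ} {α : Type*} [Fintype α] {p : (Fin k → α) → Fin k → Prop}
    (hloc : ∀ g g' i, (∀ j ≤ i, g j = g' j) → (p g i ↔ p g' i))
    (hfib : ∀ g i, 16 * (Finset.univ.filter fun v => p (Function.update g i v) i).card ≤
      Fintype.card α) :
    2 ^ k * (Finset.univ.filter fun g => k ≤ 2 * (Finset.univ.filter fun i => p g i).card).card ≤
      Fintype.card α ^ k := by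
  set Bad := Finset.univ.filter fun g => k ≤ 2 * (Finset.univ.filter fun i => p g i).card
  set Fs := Finset.univ.filter fun F : Finset (Fin k) => k ≤ 2 * F.card
  have hsub : Bad ⊆ Fs.biUnion fun F => Finset.univ.filter fun g => ∀ i ∈ F, p g i := by
    intro g hg
    simp only [Bad, Fs, Finset.mem_filter, Finset.mem_univ, true_and, Finset.mem_biUnion] at hg ⊢
    exact ⟨_, hg, fun i hi => (Finset.mem_filter.1 hi).2⟩
  have hF : ∀ F ∈ Fs, 4 ^ k * (Finset.univ.filter fun g => ∀ i ∈ F, p g i).card ≤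
      Fintype.card α ^ k := by
    intro F hF
    refine le_trans (Nat.mul_le_mul_right _ ?_) (card_adapted_le hloc hfib F)
    calc 4 ^ k ≤ 4 ^ (2 * F.card) := Nat.pow_le_pow_right (by norm_num) (Finset.mem_filter.1 hF).2
      _ = 16 ^ F.card := by rw [pow_mul]; norm_num
  -- Union bound over the at most `2 ^ k` sets `F`, each having weight at most `16 ^ (-|F|) ≤ 4 ^
  -- (-k)`.
  have h4 : 4 ^ k * Bad.card ≤ 2 ^ k * Fintype.card α ^ k := by
    calc 4 ^ k * Bad.card
        ≤ 4 ^ k * ∑ F ∈ Fs, (Finset.univ.filter fun g => ∀ i ∈ F, p g i).card :=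
          Nat.mul_le_mul_left _ ((Finset.card_le_card hsub).trans Finset.card_biUnion_le)
      _ ≤ ∑ F ∈ Fs, Fintype.card α ^ k := by
          rw [Finset.mul_sum]; exact Finset.sum_le_sum hF
      _ = Fs.card * Fintype.card α ^ k := by simp
      _ ≤ 2 ^ k * Fintype.card α ^ k := by
          refine Nat.mul_le_mul_right _ ((Finset.card_filter_le _ _).trans_eq ?_)
          simp
  have : (4 : ℕ) ^ k = 2 ^ k * 2 ^ k := by rw [← mul_pow]; norm_num
  rw [this, mul_assoc] at h4
  exact Nat.le_of_mul_le_mul_left h4 (by positivity)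

end Counting

/-! ### Measurability -/

section Measurability

variable {V M Ω : Type*} [Finite V] [Countable M] [MeasurableSpace Ω]

theorem measurableSet_preimage_of_countable {α : Type*} [Countable α] {f : Ω → α}
    (h : ∀ a, MeasurableSet {ω | f ω = a}) (s : Set α) : MeasurableSet (f ⁻¹' s) := by
  rw [← Set.biUnion_preimage_singleton]
  exact MeasurableSet.biUnion s.to_countable fun a _ => h a

/-- Histories and, since `V` is finite, joint actions take countably many values, so every event
splits into countably many pieces on which they are fixed. -/
theorem measurableSet_history (G : SimpleGraph V) (src : V) {σ : Ω → Strategy V M}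
    (hσ : ∀ v h a, MeasurableSet {ω | σ ω v h = a}) (t : ℕ) (v : V) (h : List (Option M)) :
    MeasurableSet {ω | history G src (σ ω) t v = h} := by
  induction t generalizing v h with
  | zero => simp [history]
  | succ t ih =>
    have hact : ∀ u b, MeasurableSet
        {ω | action src (σ ω) u (history G src (σ ω) t u) = b} := by
      intro u b
      have : {ω | action src (σ ω) u (history G src (σ ω) t u) = b} =
          ⋃ l : List (Option M), {ω | history G src (σ ω) t u = l} ∩
            {ω | action src (σ ω) u l = b} := by
        ext ω; simp
      rw [this]
      refine MeasurableSet.iUnion fun l => (ih u l).inter ?_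
      unfold action
      by_cases hl : Active src u l
      · simpa only [if_pos hl] using hσ u l b
      · simp only [if_neg hl, MeasurableSet.const]
    have hacts : ∀ a : V → Option M, MeasurableSet
        {ω | (fun u => action src (σ ω) u (history G src (σ ω) t u)) = a} := by
      intro a
      simp only [funext_iff, Set.ofPred_forall]
      exact MeasurableSet.iInter fun u => hact u (a u)
    have hset : {ω | history G src (σ ω) (t + 1) v = h} = ⋃ l : List (Option M),
        {ω | history G src (σ ω) t v = l} ∩
          (fun ω => fun u => action src (σ ω) u (history G src (σ ω) t u)) ⁻¹'
            {a | received G a v :: l = h} := by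
      ext ω; simp [history]
    rw [hset]
    exact MeasurableSet.iUnion fun l => (ih v l).inter
      (measurableSet_preimage_of_countable hacts _)

theorem measurableSet_informed (G : SimpleGraph V) (src : V) {σ : Ω → Strategy V M}
    (hσ : ∀ v h a, MeasurableSet {ω | σ ω v h = a}) (t : ℕ) (v : V) :
    MeasurableSet {ω | Informed G src (σ ω) t v} :=
  measurableSet_preimage_of_countable (fun h => measurableSet_history G src hσ t v h)
    {h | Active src v h}

end Measurability

/-! ### The random chain -/

section Selection

variable {k m : ℕ}

theorem card_coreN : Fintype.card (CoreN m) = (m + 1) * 2 ^ m := by simp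

instance : IsProbabilityMeasure (selection k m) := by
  unfold selection; infer_instance

theorem selection_singleton (g : Fin k → CoreN m) :
    selection k m {g} = ((Fintype.card (CoreN m) : ENNReal) ^ k)⁻¹ := by
  rw [selection, Measure.pi_singleton]
  simp [ProbabilityTheory.uniformOn_univ, ENNReal.inv_pow]

theorem selection_le_of_card_le {B : Finset (Fin k → CoreN m)}
    (h : 2 ^ k * B.card ≤ Fintype.card (CoreN m) ^ k) : selection k m B ≤ 2⁻¹ ^ k := by
  rw [← sum_measure_singleton]
  simp only [selection_singleton, Finset.sum_const, nsmul_eq_mul]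
  rw [← div_eq_mul_inv]
  refine ENNReal.div_le_of_le_mul ?_
  rw [← ENNReal.inv_pow, ← ENNReal.div_eq_inv_mul,
    ENNReal.le_div_iff_mul_le (Or.inl (by simp)) (Or.inl (by simp)), mul_comm]
  exact_mod_cast h

variable {M : Type*}

open Classical in
/-- For every deterministic protocol, all but a `2 ^ (-k)`-fraction of the chains are slow. -/
theorem selection_not_slow_le (σ : Strategy (ChainVertex k m) M) :
    selection k m {g | ¬ ∀ t < ((m + 1) / 32 + 2) * (k / 2 + 1),
      ¬ Informed (chain g) root σ t (relay g (Fin.last k))} ≤ 2⁻¹ ^ k := by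
  set J := (m + 1) / 32 with hJ
  refine le_trans (measure_mono ?_) (selection_le_of_card_le
    (card_half_adapted_le (p := FastCopy σ J) (fun g g' i h => fastCopy_congr h) fun g i => ?_))
  · intro g hg
    simp only [Finset.coe_filter, Finset.mem_univ, true_and, Set.mem_ofPred_eq] at hg ⊢
    by_contra hlt
    refine hg fun t ht => not_informed_relay J k le_rfl t (ht.trans_le (Nat.mul_le_mul_left _ ?_))
    -- Fewer than `k / 2` fast copies leave at least `⌊k/2⌋ + 1` slow ones.
    have := Finset.card_filter_add_card_filter_not (s := (Finset.univ : Finset (Fin k)))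
      (fun i => FastCopy σ J g i)
    simp only [Finset.card_univ, Fintype.card_fin] at this
    simp only [Fin.is_lt, true_and]
    omega
  · have h1 := ncard_fastCopy_update_le (σ := σ) (g := g) (i := i) J
    rw [Set.ncard_eq_toFinset_card', Set.toFinset_ofPred] at h1
    rw [card_coreN]
    -- The 32 is the 16 required by `card_half_adapted_le` times the 2 in the coverage bound `2s`.
    have h2 : 32 * J ≤ m + 1 := Nat.mul_div_le _ _
    calc _ ≤ 16 * (J * (2 * 2 ^ m)) := Nat.mul_le_mul_left _ h1
      _ = 32 * J * 2 ^ m := by ring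
      _ ≤ _ := Nat.mul_le_mul_right _ h2

variable {Ω : Type*} {σ : Ω → Strategy (ChainVertex k m) M}

/-- The event that the last relay vertex is not reached early. -/
def slowEvent (σ : Ω → Strategy (ChainVertex k m) M) : Set ((Fin k → CoreN m) × Ω) :=
  {x | ∀ t < ((m + 1) / 32 + 2) * (k / 2 + 1),
    ¬ Informed (chain x.1) root (σ x.2) t (relay x.1 (Fin.last k))}

theorem natCast_le_reachTime_of_mem_slowEvent {x : (Fin k → CoreN m) × Ω} (hx : x ∈ slowEvent σ) :
    ((((m + 1) / 32 + 2) * (k / 2 + 1) : ℕ) : ENNReal) ≤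
      (reachTime (chain x.1) root (σ x.2) (relay x.1 (Fin.last k)) : ENNReal) := by
  have := ENat.toENNReal_le.2 (natCast_le_reachTime (r := ((m + 1) / 32 + 2) * (k / 2 + 1)) hx)
  rwa [ENat.toENNReal_coe] at this

variable [Countable M] [MeasurableSpace Ω] {P : Measure Ω} [IsProbabilityMeasure P]

theorem measurableSet_slowEvent (hσ : ∀ v h a, MeasurableSet {ω | σ ω v h = a}) :
    MeasurableSet (slowEvent σ) := by
  have : slowEvent σ = ⋃ g : Fin k → CoreN m, {g} ×ˢ
      ⋂ (t : ℕ) (_ : t < ((m + 1) / 32 + 2) * (k / 2 + 1)),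
        {ω | Informed (chain g) root (σ ω) t (relay g (Fin.last k))}ᶜ := by
    ext ⟨g, ω⟩
    simp [slowEvent]
  rw [this]
  refine MeasurableSet.iUnion fun g => (measurableSet_singleton g).prod
    (MeasurableSet.iInter fun t => MeasurableSet.iInter fun _ => ?_)
  exact (measurableSet_informed _ _ hσ t _).compl

theorem measureReal_slowEvent_ge (hσ : ∀ v h a, MeasurableSet {ω | σ ω v h = a}) :
    1 - (2⁻¹ : ℝ) ^ k ≤ ((selection k m).prod P).real (slowEvent σ) := by
  have hm := measurableSet_slowEvent hσ
  have hc : ((selection k m).prod P) (slowEvent σ)ᶜ ≤ 2⁻¹ ^ k := by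
    -- Integrate over the choice of the chain first: with the coins fixed, the protocol is
    -- deterministic.
    rw [Measure.prod_apply_symm hm.compl]
    calc _ ≤ ∫⁻ _, 2⁻¹ ^ k ∂P := lintegral_mono fun ω => selection_not_slow_le (σ ω)
      _ = 2⁻¹ ^ k := by simp
  have hr : ((selection k m).prod P).real (slowEvent σ)ᶜ ≤ (2⁻¹ : ℝ) ^ k := by
    have := ENNReal.toReal_mono (by simp) hc
    simpa [measureReal_def] using this
  rw [probReal_compl_eq_one_sub hm] at hr
  linarith

end Selection

end RadioBroadcast

namespace RadioBroadcast

/-! ### Diameter and size of the chain -/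

section Diameter

variable {k m : ℕ} {g : Fin k → CoreN m}

/-- The distance of a vertex of the chain from the root, in terms of its copy and side. -/
def level : ChainVertex k m → ℕ
  | none => 0
  | some (j, Sum.inl _) => 2 * j + 1
  | some (j, Sum.inr _) => 2 * j + 2

theorem level_relay (g : Fin k → CoreN m) (i : Fin (k + 1)) : level (relay g i) = 2 * i := by
  rcases relay_eq_root_or g i with ⟨h, h'⟩ | ⟨j, h, h'⟩ <;> rw [h', h]
  · simp [level, root]
  · simp [level, inN]; ring

theorem level_le_of_adj {x y : ChainVertex k m} (h : (chain g).Adj x y) :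
    level y ≤ level x + 1 := by
  rcases chain_adj_iff.1 h with ⟨j, z, rfl, rfl | ⟨v, rfl, -⟩⟩ | ⟨j, z, rfl, rfl | ⟨v, rfl, -⟩⟩
  · rw [level_relay]; simp [level, inS]
  · simp [level, inS, inN]
  · rw [level_relay]; simp [level, inS]; omega
  · simp [level, inS, inN]

theorem level_le_of_walk {x y : ChainVertex k m} (p : (chain g).Walk x y) :
    level y ≤ level x + p.length := by
  induction p with
  | nil => simp
  | cons h p ih =>
    have := level_le_of_adj h
    rw [SimpleGraph.Walk.length_cons]
    omega

theorem edist_relay_le (j : Fin k) (y : CoreS m ⊕ CoreN m) :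
    (chain g).edist (relay g j.castSucc) (some (j, y)) ≤ 2 := by
  have hS : ∀ z, (chain g).edist (relay g j.castSucc) (inS j z) ≤ 1 := fun z =>
    (SimpleGraph.edist_eq_one_iff_adj.2
      (chain_adj_iff.2 (Or.inl ⟨j, z, rfl, Or.inl rfl⟩))).le
  rcases y with z | v
  · exact (hS z).trans (by norm_num)
  -- The vertex `(l, y)` of `N` is adjacent to the leaf number `y`.
  · have hN : (chain g).edist (inS j v.2) (inN j v) ≤ 1 :=
      (SimpleGraph.edist_eq_one_iff_adj.2
        (chain_adj_iff.2 (Or.inr ⟨j, v.2, rfl, Or.inr ⟨v, rfl, rfl⟩⟩))).le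
    exact (SimpleGraph.edist_triangle (v := inS j v.2)).trans
      ((add_le_add (hS _) hN).trans (by norm_num))

theorem edist_relay_relay_le {a b : ℕ} (hab : a ≤ b) (hb : b < k + 1) :
    (chain g).edist (relay g ⟨a, by omega⟩) (relay g ⟨b, hb⟩) ≤ (2 * (b - a) : ℕ) := by
  induction hab with
  | refl => simp
  | @step b hab ih =>
    refine (SimpleGraph.edist_triangle (v := relay g ⟨b, by omega⟩)).trans ?_
    refine (add_le_add (ih (by omega)) (edist_relay_le ⟨b, by omega⟩ (Sum.inr (g _)))).trans ?_
    have : 2 * (b + 1 - a) = 2 * (b - a) + 2 := by have : a ≤ b := hab; omega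
    rw [this]
    norm_cast

theorem edist_le (x y : ChainVertex k m) : (chain g).edist x y ≤ (2 * k + 2 : ℕ) := by
  have hroot : ∀ (j : Fin k) (y : _),
      (chain g).edist root (some (j, y)) ≤ (2 * k + 2 : ℕ) := by
    intro j y
    have h := edist_relay_relay_le (g := g) (Nat.zero_le j) (by omega)
    refine (SimpleGraph.edist_triangle (v := relay g j.castSucc)).trans
      ((add_le_add h (edist_relay_le j y)).trans ?_)
    norm_cast
    omega
  have hcopies : ∀ (i j : Fin k) (x y : _), i ≤ j →
      (chain g).edist (some (i, x)) (some (j, y)) ≤ (2 * k + 2 : ℕ) := by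
    intro i j x y hij
    have h := edist_relay_relay_le (g := g) (Fin.le_def.1 hij) (by omega)
    have hx : (chain g).edist (some (i, x)) (relay g i.castSucc) ≤ 2 := by
      rw [SimpleGraph.edist_comm]; exact edist_relay_le i x
    refine (SimpleGraph.edist_triangle (v := relay g i.castSucc)).trans
      ((add_le_add hx ((SimpleGraph.edist_triangle (v := relay g j.castSucc)).trans
        (add_le_add h (edist_relay_le j y)))).trans ?_)
    norm_cast
    omega
  rcases x with _ | ⟨i, x⟩ <;> rcases y with _ | ⟨j, y⟩
  · simp
  · exact hroot j y
  · rw [SimpleGraph.edist_comm]; exact hroot i x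
  · rcases le_total i j with h | h
    · exact hcopies i j x y h
    · rw [SimpleGraph.edist_comm]; exact hcopies j i y x h

theorem ediam_chain_le (g : Fin k → CoreN m) : (chain g).ediam ≤ (2 * k + 2 : ℕ) :=
  SimpleGraph.ediam_le_of_edist_le edist_le

theorem ediam_chain_ne_top (g : Fin k → CoreN m) : (chain g).ediam ≠ ⊤ :=
  ne_top_of_le_ne_top (ENat.natCast_ne_top _) (ediam_chain_le g)

theorem chain_connected (g : Fin k → CoreN m) : (chain g).Connected :=
  SimpleGraph.connected_of_ediam_ne_top (ediam_chain_ne_top g)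

theorem diam_chain_le (g : Fin k → CoreN m) : (chain g).diam ≤ 2 * k + 2 := by
  have := ENat.toNat_le_toNat (ediam_chain_le g) (ENat.natCast_ne_top _)
  rwa [ENat.toNat_natCast] at this

theorem le_diam_chain (g : Fin k → CoreN m) : 2 * k ≤ (chain g).diam := by
  obtain ⟨p, hp⟩ := (chain_connected g).exists_walk_length_eq_dist
    (relay g 0) (relay g (Fin.last k))
  have h := level_le_of_walk p
  rw [level_relay, level_relay, hp] at h
  have h2 := SimpleGraph.dist_le_diam (ediam_chain_ne_top g) (u := relay g 0)
    (v := relay g (Fin.last k))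
  simp at h
  omega

/-! ### The number of vertices and its relation to `log (n / D)`. -/

theorem card_chainVertex (k m : ℕ) : Nat.card (ChainVertex k m) = 1 + k * (2 ^ m * (m + 2)) := by
  simp only [ChainVertex, Nat.card_eq_fintype_card, Fintype.card_option, Fintype.card_prod,
    Fintype.card_sum, Fintype.card_fin]
  ring

/-- The largest chain of `k` core graphs with at most `n` vertices. -/
theorem exists_maximal_chain {k n : ℕ} (hk : 1 ≤ k) (hn : 2 * k + 1 ≤ n) :
    ∃ m, Nat.card (ChainVertex k m) ≤ n ∧ n < Nat.card (ChainVertex k (m + 1)) := by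
  -- This bounds every admissible `m` by `n`, so the search up to `n` finds the true maximum.
  have hgrow : ∀ m, m < Nat.card (ChainVertex k m) := by
    intro m
    rw [card_chainVertex]
    nlinarith [Nat.one_le_two_pow (n := m), mul_le_mul hk (Nat.one_le_two_pow (n := m))
      zero_le_one (Nat.zero_le k)]
  refine ⟨Nat.findGreatest (fun m => Nat.card (ChainVertex k m) ≤ n) n,
    Nat.findGreatest_spec (P := fun m => Nat.card (ChainVertex k m) ≤ n) (Nat.zero_le n) ?_, ?_⟩
  · rw [card_chainVertex]; simp; omega
  · rcases Nat.lt_or_ge n (Nat.findGreatest (fun m => Nat.card (ChainVertex k m) ≤ n) n + 1)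
      with h | h
    · exact h.trans (hgrow _)
    · exact not_le.1 (Nat.findGreatest_is_greatest
        (P := fun m => Nat.card (ChainVertex k m) ≤ n) (Nat.lt_succ_self _) h)

theorem le_three_mul_card {k m n : ℕ} (h : n < Nat.card (ChainVertex k (m + 1))) :
    n ≤ 3 * Nat.card (ChainVertex k m) := by
  rw [card_chainVertex] at h ⊢
  have : k * (2 ^ (m + 1) * (m + 1 + 2)) = 2 * (k * (2 ^ m * (m + 2))) + 2 * (k * 2 ^ m) := by ring
  have h2 : k * (2 ^ m * (m + 2)) = k * 2 ^ m * m + 2 * (k * 2 ^ m) := by ring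
  have := Nat.zero_le (k * 2 ^ m * m)
  omega

/-- `log (n / D)` is at most of the order of `log s`. -/
theorem logb_div_le {n D m : ℕ} (hD : 2 ≤ D) (hn : 0 < n)
    (h : n ≤ 3 * Nat.card (ChainVertex (D / 2) m)) :
    Real.logb 2 ((n : ℝ) / D) ≤ 2 * m + 3 := by
  have hnat : n ≤ D * 2 ^ (2 * m + 3) := by
    have h1 : m + 2 ≤ 2 ^ (m + 1) := Nat.lt_two_pow_self (n := m + 1)
    have h2 : 2 ^ m * (m + 2) ≤ 2 ^ (2 * m + 1) := by
      calc _ ≤ 2 ^ m * 2 ^ (m + 1) := Nat.mul_le_mul_left _ h1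
        _ = _ := by rw [← pow_add]; congr 1; ring
    have h3 : 2 * (D / 2 * (2 ^ m * (m + 2))) ≤ D * 2 ^ (2 * m + 1) := by
      calc _ = 2 * (D / 2) * (2 ^ m * (m + 2)) := by ring
        _ ≤ _ := Nat.mul_le_mul (Nat.mul_div_le D 2) h2
    have h4 : D * 2 ^ (2 * m + 3) = 4 * (D * 2 ^ (2 * m + 1)) := by ring
    -- This absorbs the additive constant that comes from the root.
    have h5 : 2 * 2 ≤ D * 2 ^ (2 * m + 1) := by
      refine Nat.mul_le_mul hD ?_
      rw [pow_succ]
      have := Nat.one_le_two_pow (n := 2 * m)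
      omega
    rw [card_chainVertex] at h
    omega
  have hD0 : (0 : ℝ) < D := by positivity
  rw [Real.logb_le_iff_le_rpow one_lt_two (by positivity), div_le_iff₀ hD0]
  have : (2 : ℝ) ^ (2 * (m : ℝ) + 3) = 2 ^ (2 * m + 3) := by
    rw [← Real.rpow_natCast]; push_cast; rfl
  rw [this, mul_comm]
  exact_mod_cast hnat

/-- The number of rounds of a slow broadcast is of the order of `D log (n / D)`. -/
theorem mul_logb_le {n D m : ℕ} (hD : 2 ≤ D) (hn : 0 < n)
    (h : n ≤ 3 * Nat.card (ChainVertex (D / 2) m)) :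
    1 / 400 * (D : ℝ) * Real.logb 2 ((n : ℝ) / D) ≤
      ((((m + 1) / 32 + 2) * (D / 2 / 2 + 1) : ℕ) : ℝ) := by
  -- The summand 2 in `J + 2` keeps the bound useful for small `m`, where `J = 0`. Together with
  -- `h2` the number of rounds is at least `D (m + 34) / 128`, which exceeds `D (2m + 3) / 400`.
  have h1 : (m : ℝ) + 34 ≤ 32 * (((m + 1) / 32 + 2 : ℕ) : ℝ) := by
    have : m + 34 ≤ 32 * ((m + 1) / 32 + 2) := by omega
    exact_mod_cast this
  have h2 : (D : ℝ) ≤ 4 * ((D / 2 / 2 + 1 : ℕ) : ℝ) := by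
    have : D ≤ 4 * (D / 2 / 2 + 1) := by omega
    exact_mod_cast this
  have h3 := mul_le_mul h1 h2 (by positivity) (by positivity)
  have h4 := mul_le_mul_of_nonneg_left (logb_div_le hD hn h) (by positivity : (0 : ℝ) ≤ D)
  rw [Nat.cast_mul]
  nlinarith [mul_nonneg (Nat.cast_nonneg D : (0 : ℝ) ≤ D) (Nat.cast_nonneg m : (0 : ℝ) ≤ m)]

end Diameter

/-! ### The two parts of the theorem -/

section Main

/-- Reaching a `2 i / log 2s`-fraction of `N` in a single core graph takes `1 + i` rounds. -/
theorem one_add_le_of_ncard_informed {m : ℕ} {M : Type*} (σ : Strategy (ChainVertex 1 m) M)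
    (g : Fin 1 → CoreN m) (i : ℝ) (t : ℕ)
    (hne : {v : CoreN m | Informed (chain g) root σ t (inN 0 v)}.Nonempty)
    (h : 2 * i / Real.logb 2 (2 * 2 ^ m) * (Nat.card (CoreN m) : ℝ) ≤
      ({v : CoreN m | Informed (chain g) root σ t (inN 0 v)}.ncard : ℝ)) :
    1 + i ≤ (t : ℝ) := by
  -- For `i = 0` the fraction condition is void; only nonemptiness rules out `t = 0`.
  rcases t with _ | t
  · obtain ⟨v, hv⟩ := hne
    exact absurd hv (not_informed_zero (by simp [inN, root]))
  · have hlog : Real.logb 2 (2 * 2 ^ m) = m + 1 := by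
      rw [← pow_succ', Real.logb_pow, Real.logb_self_eq_one one_lt_two]
      push_cast; ring
    have hG : chain g = chainUpTo g 0 :=
      (chainUpTo_eq_chain g fun j => (Subsingleton.elim j 0).le).symm
    have hle := ncard_informed_le (H := chain g) (σ := σ) (i := 0) (b := 0)
      (fun v x => by rw [hG]; exact chainUpTo_adj_inN)
      (fun z => not_informed_zero (by simp [inS, root])) t
    rw [show 0 + 1 + t = t + 1 by ring] at hle
    have hle' : (({v : CoreN m | Informed (chain g) root σ (t + 1) (inN 0 v)}.ncard : ℕ) : ℝ) ≤
        t * (2 * 2 ^ m) := by exact_mod_cast hle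
    rw [hlog, Nat.card_eq_fintype_card, card_coreN] at h
    have hm : (0 : ℝ) < m + 1 := by positivity
    have h2 : 2 * i / ((m : ℝ) + 1) * (((m + 1) * 2 ^ m : ℕ) : ℝ) = i * (2 * 2 ^ m) := by
      push_cast
      field_simp
    rw [h2] at h
    have := le_of_mul_le_mul_right (h.trans hle') (by positivity)
    push_cast
    linarith

theorem half_pow_le_rpow {n D : ℕ} {C : ℝ} (hD : 2 ≤ D) (hn : 0 < n)
    (h : 3 * C * Real.logb 2 n ≤ D) : (2⁻¹ : ℝ) ^ (D / 2) ≤ (n : ℝ) ^ (-C) := by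
  have hn' : (0 : ℝ) < n := by exact_mod_cast hn
  -- The factor 3 is attained at `D = 3`, where `⌊D/2⌋ = 1`.
  have hk : (D : ℝ) ≤ 3 * (D / 2 : ℕ) := by
    have : D ≤ 3 * (D / 2) := by omega
    exact_mod_cast this
  have hlhs : (2⁻¹ : ℝ) ^ (D / 2) = (2 : ℝ) ^ (-((D / 2 : ℕ) : ℝ)) := by
    rw [Real.rpow_neg (by norm_num), Real.rpow_natCast, inv_pow]
  have hrhs : (n : ℝ) ^ (-C) = (2 : ℝ) ^ (Real.logb 2 n * -C) := by
    rw [Real.rpow_mul (by norm_num), Real.rpow_logb (by norm_num) (by norm_num) hn']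
  rw [hlhs, hrhs]
  exact Real.rpow_le_rpow_of_exponent_le one_le_two (by linarith)

variable {k m : ℕ} {M Ω : Type*} [Countable M] [MeasurableSpace Ω] {P : Measure Ω}
  [IsProbabilityMeasure P] {σ : Ω → Strategy (ChainVertex k m) M}

/-- The expected time to reach the last relay vertex is at least half of the time in the slow
event. -/
theorem ofReal_le_lintegral_reachTime (hk : 1 ≤ k)
    (hσ : ∀ v h a, MeasurableSet {ω | σ ω v h = a}) {r : ℝ}
    (hr : 2 * r ≤ ((((m + 1) / 32 + 2) * (k / 2 + 1) : ℕ) : ℝ)) :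
    ENNReal.ofReal r ≤ ∫⁻ x, (reachTime (chain x.1) root (σ x.2) (relay x.1 (Fin.last k)) : ENNReal)
      ∂((selection k m).prod P) := by
  set q := ((m + 1) / 32 + 2) * (k / 2 + 1) with hq
  have hP := measureReal_slowEvent_ge (P := P) hσ
  have hpow : (2⁻¹ : ℝ) ^ k ≤ 2⁻¹ := by
    simpa using pow_le_pow_of_le_one (by norm_num : (0 : ℝ) ≤ 2⁻¹) (by norm_num) hk
  have hreal : r ≤ q * ((selection k m).prod P).real (slowEvent σ) := by
    nlinarith [(Nat.cast_nonneg q : (0 : ℝ) ≤ q)]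
  calc ENNReal.ofReal r ≤ ENNReal.ofReal (q * ((selection k m).prod P).real (slowEvent σ)) :=
        ENNReal.ofReal_le_ofReal hreal
    _ = q * ((selection k m).prod P) (slowEvent σ) := by
        rw [ENNReal.ofReal_mul (by positivity), ENNReal.ofReal_natCast, ofReal_measureReal]
    _ = ∫⁻ x, (slowEvent σ).indicator (fun _ => (q : ENNReal)) x ∂((selection k m).prod P) := by
        rw [lintegral_indicator_const (measurableSet_slowEvent hσ)]
    _ ≤ _ := lintegral_mono fun x => Set.indicator_le
        (fun x hx => natCast_le_reachTime_of_mem_slowEvent hx) x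

/-- The time to reach the last relay vertex is large with high probability. -/
theorem measureReal_le_reachTime_ge (hσ : ∀ v h a, MeasurableSet {ω | σ ω v h = a}) {r : ℝ}
    (hr : r ≤ ((((m + 1) / 32 + 2) * (k / 2 + 1) : ℕ) : ℝ)) :
    1 - (2⁻¹ : ℝ) ^ k ≤ ((selection k m).prod P).real
      {x | ENNReal.ofReal r ≤
        (reachTime (chain x.1) root (σ x.2) (relay x.1 (Fin.last k)) : ENNReal)} := by
  refine (measureReal_slowEvent_ge hσ).trans (measureReal_mono fun x hx => ?_)
  refine le_trans ?_ (natCast_le_reachTime_of_mem_slowEvent hx)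
  rw [← ENNReal.ofReal_natCast]
  exact ENNReal.ofReal_le_ofReal hr

end Main

end RadioBroadcast

theorem mainTheorem6 :
    -- the rounds needed to reach a fraction of the side `N` of one core graph, `s = 2 ^ m`
    (∀ (m : ℕ) (M : Type*) (σ : Strategy (ChainVertex 1 m) M) (g : Fin 1 → CoreN m) (i : ℝ) (t : ℕ),
      0 ≤ i → i ≤ Real.logb 2 (2 * 2 ^ m) / 2 →
      {v : CoreN m | Informed (chain g) root σ t (inN 0 v)}.Nonempty →
      2 * i / Real.logb 2 (2 * 2 ^ m) * (Nat.card (CoreN m) : ℝ) ≤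
        ({v : CoreN m | Informed (chain g) root σ t (inN 0 v)}.ncard : ℝ) →
      1 + i ≤ (t : ℝ)) ∧
    -- the lower bound on the broadcast time
    ∃ c : ℝ, 0 < c ∧ ∃ A : ℝ → ℝ, ∀ n D : ℕ, 2 ≤ D → 2 * (D / 2) + 1 ≤ n →
      ∃ m : ℕ,
        Nat.card (ChainVertex (D / 2) m) ≤ n ∧ n < Nat.card (ChainVertex (D / 2) (m + 1)) ∧
        n ≤ 3 * Nat.card (ChainVertex (D / 2) m) ∧
        (∀ g : Fin (D / 2) → CoreN m, (chain g).Connected ∧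
          2 * (D / 2) ≤ (chain g).diam ∧ (chain g).diam ≤ 2 * (D / 2) + 2) ∧
        ∀ (M : Type*) [Countable M] (Ω : Type*) [MeasurableSpace Ω]
          (P : Measure Ω) [IsProbabilityMeasure P] (σ : Ω → Strategy (ChainVertex (D / 2) m) M),
          (∀ v h a, MeasurableSet {ω | σ ω v h = a}) →
          -- in expectation
          (ENNReal.ofReal (c * D * Real.logb 2 (n / D)) ≤
              ∫⁻ x, (reachTime (chain x.1) root (σ x.2) (relay x.1 (Fin.last _)) : ENNReal)
                ∂((selection (D / 2) m).prod P) ∧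
            ENNReal.ofReal (c * D * Real.logb 2 (n / D)) ≤
              ∫⁻ x, (broadcastTime (chain x.1) root (σ x.2) : ENNReal)
                ∂((selection (D / 2) m).prod P)) ∧
          -- with high probability
          ∀ C : ℝ, A C * Real.logb 2 n ≤ D →
            1 - (n : ℝ) ^ (-C) ≤ ((selection (D / 2) m).prod P).real
              {x | ENNReal.ofReal (c * D * Real.logb 2 (n / D)) ≤
                (reachTime (chain x.1) root (σ x.2) (relay x.1 (Fin.last _)) : ENNReal)} ∧
            1 - (n : ℝ) ^ (-C) ≤ ((selection (D / 2) m).prod P).real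
              {x | ENNReal.ofReal (c * D * Real.logb 2 (n / D)) ≤
                (broadcastTime (chain x.1) root (σ x.2) : ENNReal)} := by
  -- The constant is half of the `1 / 400` in `mul_logb_le`, because the expectation bound uses only
  -- that the slow event has probability at least `1/2`. The choice `3 * C` makes `2 ^ (-⌊D/2⌋) ≤ n
  -- ^ (-C)`.
  refine ⟨fun m M σ g i t _ _ hne h => one_add_le_of_ncard_informed σ g i t hne h,
    1 / 800, by norm_num, fun C => 3 * C, fun n D hD hn => ?_⟩
  obtain ⟨m, hm, hm'⟩ := exists_maximal_chain (k := D / 2) (by omega) hn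
  have hn3 := le_three_mul_card hm'
  refine ⟨m, hm, hm', hn3,
    fun g => ⟨chain_connected g, le_diam_chain g, diam_chain_le g⟩, ?_⟩
  intro M _ Ω _ P _ σ hσ
  have hbound := mul_logb_le hD (by omega) hn3
  have hr : 2 * (1 / 800 * (D : ℝ) * Real.logb 2 (n / D)) ≤
      ((((m + 1) / 32 + 2) * (D / 2 / 2 + 1) : ℕ) : ℝ) := le_trans (le_of_eq (by ring)) hbound
  have hr' : 1 / 800 * (D : ℝ) * Real.logb 2 (n / D) ≤
      ((((m + 1) / 32 + 2) * (D / 2 / 2 + 1) : ℕ) : ℝ) := by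
    have : (0 : ℝ) ≤ ((((m + 1) / 32 + 2) * (D / 2 / 2 + 1) : ℕ) : ℝ) := Nat.cast_nonneg _
    linarith
  have hmono : ∀ x : (Fin (D / 2) → CoreN m) × Ω,
      (reachTime (chain x.1) root (σ x.2) (relay x.1 (Fin.last _)) : ENNReal) ≤
        (broadcastTime (chain x.1) root (σ x.2) : ENNReal) := fun x =>
    ENat.toENNReal_le.2 (reachTime_le_broadcastTime _)
  have hE := ofReal_le_lintegral_reachTime (P := P) (by omega) hσ hr
  refine ⟨⟨hE, hE.trans (lintegral_mono hmono)⟩, fun C hC => ?_⟩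
  have hR : 1 - (n : ℝ) ^ (-C) ≤ _ :=
    (sub_le_sub_left (half_pow_le_rpow hD (by omega) hC) 1).trans
      (measureReal_le_reachTime_ge (P := P) hσ hr')
  exact ⟨hR, hR.trans (measureReal_mono fun x hx => hx.trans (hmono x))⟩
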